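/- Consider a closed chain of $n$ sites with basis states $|1\rangle,\dots,|n\rangle$ (single-excitation sector) and long-range Hamiltonian $$H=\sum_{i<j}J_{ij}\big(|i\rangle\langle j|+|j\rangle\langle i|\big),\qquad J_{ij}=\frac1{|j-i|^{\alpha}}+\frac1{|n-(j-i)|^{\alpha}} .$$ For a marked site $w$ and a hopping rate $\gamma\in\mathbb R$, spatial search evolves $|s\rangle=n^{-1/2}\sum_j|j\rangle$ under $H_{\rm search}=\gamma H+|w\rangle\langle w|$ for a time $T\ge 0$ and finds $w$ with probability $F=|\langle w|e^{-iH_{\rm search}T}|s\rangle|^2$. Optimal spatial search exists for $\alpha$ if there are $\gamma_n$, $T_n\ge0$ (not depending on $w$) and constants $C$, $p>0$ such that, for all large $n$, $T_n\le C\sqrt n$ and $F\ge p$ for every $w$. Put $\beta(\alpha)=\min(\alpha-1,1)$, so $\beta(\alpha)=\alpha-1$ for $1<\alpha<2$ and $\beta(\alpha)=1$ for $\alpha\ge2$. 1. (Light-cone bound.) For every $\alpha>1$ there are constants $c>0$ and $K$, depending only on $\alpha$, such that for all $n,w,\gamma$ and $T\ge0$ with $nF\ge K$ one has $|\gamma|\,T\ge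 c\,F^{3/2}\,n^{\beta(\alpha)}$. 2. (Search time.) For every $\alpha>1$ and every $p>0$ there are $c>0$ and $N$, depending only on $\alpha$ and $p$, such that for all $n\ge N$ and all $w$, $\gamma$ and $T\ge0$: if $F\ge p$, then $T\ge c\,n^{\beta(\alpha)}$. Thus the search time is at least of order $n^{\alpha-1}$ for $1<\alpha<2$, and at least of order $n$ for $\alpha\ge2$. 3. (No optimal search for $\alpha>1.5$.) For every $\alpha>3/2$ this lower bound exceeds $\sqrt n$ in order, $n^{\beta(\alpha)}/\sqrt n\to\infty$, and optimal spatial search does not exist. -/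

import Mathlib

noncomputable section

namespace SpatialSearch

/-- Interaction strength `1 / |j - i| ^ α + 1 / |n - |j - i|| ^ α` between two distinct sites of a
closed chain of `n` sites with power-law interactions; there is no self-interaction. -/
def coupling (n : ℕ) (α : ℝ) (i j : Fin n) : ℝ :=
  if i = j then 0
  else 1 / |(j : ℝ) - (i : ℝ)| ^ α + 1 / ((n : ℝ) - |(j : ℝ) - (i : ℝ)|) ^ α

/-- The chain Hamiltonian `∑_{i<j} J_{ij} (|i⟩⟨j| + |j⟩⟨i|)` in the single-excitation basis. -/
def chainHamiltonian (n : ℕ) (α : ℝ) : Matrix (Fin n) (Fin n) ℂ :=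
  Matrix.of fun i j => (coupling n α i j : ℂ)

/-- The search Hamiltonian `γ H + |w⟩⟨w|` with marked site `w` and hopping rate `γ`. -/
def searchHamiltonian (n : ℕ) (α γ : ℝ) (w : Fin n) : Matrix (Fin n) (Fin n) ℂ :=
  (γ : ℂ) • chainHamiltonian n α + Matrix.single w w 1

/-- The uniform superposition `|s⟩ = n^{-1/2} ∑_j |j⟩`. -/
def uniformState (n : ℕ) : Fin n → ℂ := fun _ => ((1 / √(n : ℝ) : ℝ) : ℂ)

/-- The probability `|⟨w| exp(-i T H_search) |s⟩|²` of finding the marked site after time `T`. -/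
def fidelity (n : ℕ) (α γ : ℝ) (w : Fin n) (T : ℝ) : ℝ :=
  ‖(NormedSpace.exp ((-(Complex.I * (T : ℂ))) • searchHamiltonian n α γ w)).mulVec
    (uniformState n) w‖ ^ 2

/-- Optimal spatial search: hopping rates `γ n` and evolution times `T n = O(√n)` (neither
depending on which site is marked) for which the marked site is found with probability bounded
below by a positive constant, for all large `n`. -/
def OptimalSearch (α : ℝ) : Prop :=
  ∃ (γ T : ℕ → ℝ) (C p : ℝ), 0 < p ∧
    ∀ᶠ n : ℕ in Filter.atTop, 0 ≤ T n ∧ T n ≤ C * √(n : ℝ) ∧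
      ∀ w : Fin n, p ≤ fidelity n α (γ n) w (T n)

end SpatialSearch

end

/-! Let D be multiplication by the plane wave exp(2πij/n). It commutes with the marked projector and
raises momentum by one, so the norm of [H, D] is at most the largest increment of the dispersion
relation, which is O(n^(-β)) (`exists_abs_dispersion_succ_sub_le`,
`commutator_chainHamiltonian_clock`). Averaging M powers of D with phases gives a Dirichlet kernel g
equal to 1 at w, while g applied to the uniform state has norm 1/√M. Moving g through the evolution
costs at most a commutator, so √F ≤ 1/√M + |γ| T M O(n^(-β)) (`sqrt_fidelity_le`). Taking M of order
1/F gives the light-cone bound.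

To remove γ, use conservation of energy: γ times the Dirichlet form of the final state equals 2(F -
1/n). A normalised state with weight p at w must have small amplitude at some site within a bounded
distance of w, so its Dirichlet form is bounded below uniformly in n and |γ| is bounded
(`exists_abs_hopping_le`). Hence T is at least of order n^β, which beats √n once α > 3/2. -/

open Finset Real in
/-- Eigenvalue of the chain Hamiltonian for the plane wave with quasi-momentum `2πk/n`. -/
noncomputable def SpatialSearch.dispersion (n : ℕ) (α : ℝ) (k : ℕ) : ℝ :=
  2 * ∑ d ∈ Ico 1 n, cos (2 * π * (d * k / n)) / (d : ℝ) ^ α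

/-! ### Increments of the dispersion relation -/

namespace SpatialSearch
open Finset Real

/-- By Bernoulli's inequality for exponents at most 1, each term is at most the increment of x^s / s
over [d, d + 1]; the sum telescopes. -/
theorem sum_range_add_one_rpow_sub_one_le {s : ℝ} (hs : 0 < s) (hs1 : s ≤ 1) (n : ℕ) :
    ∑ d ∈ range n, ((d : ℝ) + 1) ^ (s - 1) ≤ (n : ℝ) ^ s / s := by
  induction n with
  | zero => simp [Real.zero_rpow hs.ne']
  | succ n ih =>
    rw [sum_range_succ]
    have hn : (0 : ℝ) < n + 1 := by positivity
    have h1 : (1 + -(1 / ((n : ℝ) + 1))) ^ s ≤ 1 + s * -(1 / ((n : ℝ) + 1)) := by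
      refine rpow_one_add_le_one_add_mul_self ?_ hs.le hs1
      rw [neg_le_neg_iff, div_le_one hn]
      linarith [n.cast_nonneg (α := ℝ)]
    have h2 : (n : ℝ) ^ s = ((n : ℝ) + 1) ^ s * (1 + -(1 / ((n : ℝ) + 1))) ^ s := by
      have : 1 + -(1 / ((n : ℝ) + 1)) = n / (n + 1) := by field_simp; ring
      rw [this, ← mul_rpow hn.le (by positivity), mul_div_cancel₀ _ hn.ne']
    have h3 : (n : ℝ) ^ s ≤ ((n : ℝ) + 1) ^ s - s * ((n : ℝ) + 1) ^ (s - 1) := by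
      rw [h2, rpow_sub_one hn.ne']
      refine (mul_le_mul_of_nonneg_left h1 (by positivity)).trans_eq ?_
      ring
    push_cast
    calc _ ≤ (n : ℝ) ^ s / s + ((n : ℝ) + 1) ^ (s - 1) := by gcongr
      _ = ((n : ℝ) ^ s + s * ((n : ℝ) + 1) ^ (s - 1)) / s := by field_simp
      _ ≤ _ := by gcongr; linarith

/-- Cosine is 1-Lipschitz and the phase at distance d moves by 2πd/n. Good enough except at α = 2,
where it loses a logarithm. -/
theorem abs_dispersion_succ_sub_le_sum (n : ℕ) (α : ℝ) (k : ℕ) :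
    |dispersion n α (k + 1) - dispersion n α k| ≤
      4 * π / n * ∑ d ∈ range (n - 1), ((d : ℝ) + 1) ^ (1 - α) := by
  rw [dispersion, dispersion, ← mul_sub, ← sum_sub_distrib, abs_mul, abs_two,
    sum_Ico_eq_sum_range, mul_sum]
  refine (mul_le_mul_of_nonneg_left (abs_sum_le_sum_abs _ _) zero_le_two).trans ?_
  rw [mul_sum]
  refine sum_le_sum fun d _ => ?_
  have hd : (0 : ℝ) < (d : ℝ) + 1 := by positivity
  push_cast
  rw [add_comm (1 : ℝ) d, ← sub_div, abs_div, abs_of_pos (rpow_pos_of_pos hd α),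
    sub_eq_add_neg 1 α, rpow_add hd, rpow_one, rpow_neg hd.le]
  have h := abs_cos_sub_cos_le (2 * π * ((d + 1) * (k + 1) / n)) (2 * π * ((d + 1) * k / n))
  have h' : |2 * π * (((d : ℝ) + 1) * (k + 1) / n) - 2 * π * ((d + 1) * k / n)|
      = 2 * π * (d + 1) / n := by
    rw [← abs_of_nonneg (show (0 : ℝ) ≤ 2 * π * (d + 1) / n by positivity)]
    congr 1; ring
  rw [h'] at h
  calc _ ≤ 2 * ((2 * π * (d + 1) / n) / ((d : ℝ) + 1) ^ α) := by gcongr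
    _ = _ := by ring

theorem hasSum_cos_div_sq {x : ℝ} (hx : x ∈ Set.Icc (0 : ℝ) 1) :
    HasSum (fun d : ℕ => cos (2 * π * (d * x)) / (d : ℝ) ^ 2) (π ^ 2 * (x ^ 2 - x + 1 / 6)) := by
  convert hasSum_one_div_nat_pow_mul_cos one_ne_zero hx using 1
  · ext d; rw [mul_assoc (2 * π)]; simp [div_eq_inv_mul]
  · have : Polynomial.bernoulli 2 = Polynomial.X ^ 2 - Polynomial.X + Polynomial.C (1 / 6) := by
      rw [Polynomial.bernoulli_def]
      simp only [sum_range_succ, range_zero, sum_empty,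
        ← Polynomial.C_mul_X_pow_eq_monomial, Nat.choose]
      norm_num
      ring
    simp [this]
    ring_nf
    simp

theorem abs_tsum_cos_div_sq_tail_le {n : ℕ} (hn : 1 ≤ n) (x : ℝ) :
    |∑' d : ℕ, cos (2 * π * ((d + n : ℕ) * x)) / ((d + n : ℕ) : ℝ) ^ 2| ≤ 2 / n := by
  have hb (d : ℕ) : ‖cos (2 * π * ((d + n : ℕ) * x)) / ((d + n : ℕ) : ℝ) ^ 2‖ ≤
      (((d + n : ℕ) : ℝ) ^ 2)⁻¹ := by
    rw [norm_div, norm_pow, Real.norm_natCast, ← one_div]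
    gcongr
    exact abs_cos_le_one _
  have hs : Summable fun d : ℕ => (((d + n : ℕ) : ℝ) ^ 2)⁻¹ :=
    (summable_nat_add_iff n).2 (Real.summable_nat_pow_inv.2 one_lt_two)
  refine (tsum_of_norm_bounded hs.hasSum hb).trans ?_
  refine Real.tsum_le_of_sum_range_le (fun d => by positivity) fun N => ?_
  have h := sum_Ioo_inv_sq_le (α := ℝ) (n - 1) (n + N)
  have e : Ioo (n - 1) (n + N) = Ico n (n + N) := by ext; simp; omega
  rw [e, sum_Ico_eq_sum_range, Nat.cast_sub hn] at h
  simpa [add_comm] using h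

/-- The full cosine series is a quadratic polynomial in k/n, hence Lipschitz there, and truncating
it at n costs only O(1/n). This avoids the logarithm of the termwise estimate. -/
theorem abs_dispersion_two_succ_sub_le {n k : ℕ} (hk : k < n) :
    |dispersion n 2 (k + 1) - dispersion n 2 k| ≤ (2 * π ^ 2 + 8) / n := by
  have hn : 1 ≤ n := by omega
  have hn0 : (0 : ℝ) < n := by exact_mod_cast hn
  have key (j : ℕ) (hj : j ≤ n) : |dispersion n 2 j -
      2 * (π ^ 2 * (((j : ℝ) / n) ^ 2 - (j : ℝ) / n + 1 / 6))| ≤ (4 / n : ℝ) := by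
    have hx : (j : ℝ) / n ∈ Set.Icc (0 : ℝ) 1 :=
      ⟨by positivity, div_le_one_of_le₀ (by exact_mod_cast hj) hn0.le⟩
    have h := hasSum_cos_div_sq hx
    have h2 := h.summable.sum_add_tsum_nat_add n
    rw [h.tsum_eq] at h2
    have h3 : dispersion n 2 j
        = 2 * ∑ d ∈ range n, cos (2 * π * (d * ((j : ℝ) / n))) / (d : ℝ) ^ 2 := by
      rw [dispersion, range_eq_Ico, sum_eq_sum_Ico_succ_bot (by omega : 0 < n)]
      simp [mul_div_assoc]
    have h4 := abs_tsum_cos_div_sq_tail_le hn ((j : ℝ) / n)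
    rw [h3, ← h2, ← mul_sub, sub_add_cancel_left, abs_mul, abs_neg, abs_two]
    calc _ ≤ 2 * (2 / (n : ℝ)) := by gcongr
      _ = _ := by ring
  have h1 := abs_le.1 (key (k + 1) hk)
  have h0 := abs_le.1 (key k hk.le)
  have hk' : ((k : ℝ) + 1) / n ≤ 1 := div_le_one_of_le₀ (by exact_mod_cast hk) hn0.le
  have e : (((k + 1 : ℕ) : ℝ) / n) = k / n + 1 / n := by push_cast; ring
  rw [add_div] at hk'
  rw [e] at h1
  have hkn : (0 : ℝ) ≤ k / n := by positivity
  have hn' : (0 : ℝ) < 1 / n := by positivity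
  have e4 : (4 : ℝ) / n = 4 * (1 / n) := by ring
  rw [e4] at h0 h1
  have e5 : (2 * π ^ 2 + 8) / n = (2 * π ^ 2 + 8) * (1 / n : ℝ) := by ring
  rw [e5]
  -- The quadratic moves by y(2x + y - 1), which lies in [-y, y] because 0 ≤ x and x + y ≤ 1.
  generalize (k : ℝ) / n = x at *
  generalize (1 : ℝ) / n = y at *
  have hp : 0 ≤ π ^ 2 * y := by positivity
  rw [abs_le]
  constructor
  · nlinarith [mul_nonneg hp hkn, mul_nonneg hp hn'.le]
  · nlinarith [mul_nonneg hp (sub_nonneg.2 hk'), mul_nonneg hp hkn, mul_nonneg hp hn'.le]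

theorem exists_abs_dispersion_succ_sub_le {α : ℝ} (hα : 1 < α) : ∃ C : ℝ, 0 < C ∧
    ∀ n k : ℕ, k < n →
      |dispersion n α (k + 1) - dispersion n α k| ≤ C / (n : ℝ) ^ min (α - 1) 1 := by
  rcases lt_trichotomy α 2 with h | rfl | h
  · refine ⟨4 * π / (2 - α), div_pos (by positivity) (by linarith), fun n k hk => ?_⟩
    have hn : (0 : ℝ) < n := by exact_mod_cast (by omega : 0 < n)
    refine (abs_dispersion_succ_sub_le_sum n α k).trans ?_
    have h1 := sum_range_add_one_rpow_sub_one_le (s := 2 - α) (by linarith) (by linarith) (n - 1)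
    have h2 : (((n - 1 : ℕ) : ℝ)) ^ (2 - α) ≤ (n : ℝ) ^ (2 - α) :=
      rpow_le_rpow (by positivity) (by exact_mod_cast n.sub_le 1) (by linarith)
    rw [show 2 - α - 1 = 1 - α by ring] at h1
    have h3 : 0 < 2 - α := by linarith
    rw [min_eq_left (by linarith)]
    calc _ ≤ 4 * π / n * ((n : ℝ) ^ (2 - α) / (2 - α)) := by
          gcongr; exact h1.trans (by gcongr)
      _ = _ := by
        rw [show 2 - α = 1 - (α - 1) by ring, rpow_sub hn, rpow_one]
        field_simp
  · refine ⟨2 * π ^ 2 + 8, by positivity, fun n k hk => ?_⟩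
    refine (abs_dispersion_two_succ_sub_le hk).trans_eq ?_
    norm_num
  · have hs : Summable fun d : ℕ => ((d : ℝ) + 1) ^ (1 - α) := by
      have := (summable_nat_add_iff 1).2 (Real.summable_nat_rpow.2 (by linarith : 1 - α < -1))
      exact_mod_cast this
    have h0 : 0 ≤ ∑' d : ℕ, ((d : ℝ) + 1) ^ (1 - α) := tsum_nonneg fun d => by positivity
    refine ⟨4 * π * (∑' d : ℕ, ((d : ℝ) + 1) ^ (1 - α) + 1), by positivity, fun n k hk => ?_⟩
    refine (abs_dispersion_succ_sub_le_sum n α k).trans ?_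
    rw [min_eq_right (by linarith), rpow_one]
    calc _ ≤ 4 * π / n * (∑' d : ℕ, ((d : ℝ) + 1) ^ (1 - α) + 1) := by
          gcongr
          exact (hs.sum_le_tsum _ fun d _ => by positivity).trans (by linarith)
      _ = _ := by ring

end SpatialSearch
-- Fourier diagonalisation and the commutator with the clock
/-- The primitive `n`-th root of unity `exp (2πi/n)`. -/
noncomputable def SpatialSearch.root (n : ℕ) : ℂ := Complex.exp (2 * Real.pi * Complex.I / n)

/-- Multiplication by the plane wave `j ↦ exp (2πij/n)`. -/
noncomputable def SpatialSearch.clock (n : ℕ) : Matrix (Fin n) (Fin n) ℂ :=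
  Matrix.diagonal fun j => SpatialSearch.root n ^ (j : ℕ)

/-- The unitary discrete Fourier transform. -/
noncomputable def SpatialSearch.fourierMatrix (n : ℕ) : Matrix (Fin n) (Fin n) ℂ :=
  Matrix.of fun j k => ((1 / √(n : ℝ) : ℝ) : ℂ) * SpatialSearch.root n ^ ((j : ℕ) * k)

namespace SpatialSearch
open Finset Real Matrix
open scoped Matrix.Norms.L2Operator

theorem root_isPrimitiveRoot {n : ℕ} (hn : n ≠ 0) : IsPrimitiveRoot (root n) n :=
  Complex.isPrimitiveRoot_exp n hn

theorem norm_root (n : ℕ) : ‖root n‖ = 1 := by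
  rw [root, show 2 * (π : ℂ) * Complex.I / n = ((2 * π / n : ℝ) : ℂ) * Complex.I by
    push_cast; ring, Complex.norm_exp_ofReal_mul_I]

theorem root_ne_zero (n : ℕ) : root n ≠ 0 := by
  rw [← norm_ne_zero_iff, norm_root]; exact one_ne_zero

theorem conj_root (n : ℕ) : star (root n) = (root n)⁻¹ := by
  rw [Complex.inv_def, Complex.normSq_eq_norm_sq, norm_root]; simp

theorem re_root_pow (n a : ℕ) : (root n ^ a).re = cos (2 * π * (a / n)) := by
  rw [root, ← Complex.exp_nat_mul, show (a : ℂ) * (2 * (π : ℂ) * Complex.I / n)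
    = ((2 * π * (a / n) : ℝ) : ℂ) * Complex.I by push_cast; ring, Complex.exp_ofReal_mul_I_re]

theorem root_pow_sub_mul {n d : ℕ} (hd : d ≤ n) (hn : n ≠ 0) (a : ℕ) :
    root n ^ ((n - d) * a) = star (root n ^ (d * a)) := by
  have h : root n ^ n = 1 := (root_isPrimitiveRoot hn).pow_eq_one
  rw [star_pow, conj_root, inv_pow, eq_comm, inv_eq_of_mul_eq_one_left]
  rw [← pow_add, ← add_mul, Nat.sub_add_cancel hd, pow_mul, h, one_pow]

/-- The chain is translation invariant: wrapping past site n merely swaps the two terms of the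
coupling. -/
theorem coupling_self_add {n : ℕ} [NeZero n] (α : ℝ) (i d : Fin n) (hd : d ≠ 0) :
    coupling n α i (i + d) = 1 / ((d : ℕ) : ℝ) ^ α + 1 / ((n : ℝ) - (d : ℕ)) ^ α := by
  have h : i ≠ i + d := fun h => hd (by simpa using h)
  rw [coupling, if_neg h]
  have hi := i.isLt
  have hdn := d.isLt
  rcases lt_or_ge ((i : ℕ) + d) n with h1 | h1
  · have e : ((i + d : Fin n) : ℕ) = i + d := by rw [Fin.val_add, Nat.mod_eq_of_lt h1]
    rw [e]; push_cast
    rw [add_sub_cancel_left, abs_of_nonneg (by positivity)]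
  · have e : ((i + d : Fin n) : ℕ) = i + d - n := by
      rw [Fin.val_add, Nat.mod_eq_sub_mod h1, Nat.mod_eq_of_lt (by omega)]
    rw [e, Nat.cast_sub h1]; push_cast
    have : (d : ℝ) ≤ n := by exact_mod_cast hdn.le
    rw [show (i : ℝ) + d - n - i = -(n - d) by ring, abs_neg, abs_of_nonneg (by linarith),
      add_comm]
    simp

theorem coupling_self (n : ℕ) (α : ℝ) (i : Fin n) : coupling n α i i = 0 := by simp [coupling]

theorem coupling_comm (n : ℕ) (α : ℝ) (i j : Fin n) : coupling n α i j = coupling n α j i := by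
  simp only [coupling, abs_sub_comm (j : ℝ) i, eq_comm (a := i)]

theorem sum_coupling_mul_root_pow {n : ℕ} (α : ℝ) (i : Fin n) (a : ℕ) :
    ∑ j : Fin n, (coupling n α i j : ℂ) * root n ^ ((j : ℕ) * a) =
      dispersion n α a * root n ^ ((i : ℕ) * a) := by
  have hn : n ≠ 0 := i.pos.ne'
  have : NeZero n := ⟨hn⟩
  have hr : root n ^ n = 1 := (root_isPrimitiveRoot hn).pow_eq_one
  rw [← Equiv.sum_comp (Equiv.addLeft i)]
  have h1 (d : Fin n) : (coupling n α i (Equiv.addLeft i d) : ℂ) *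
      root n ^ ((Equiv.addLeft i d : ℕ) * a) =
      (if (d : ℕ) = 0 then 0 else ((1 / ((d : ℕ) : ℝ) ^ α + 1 / ((n : ℝ) - (d : ℕ)) ^ α : ℝ) : ℂ)
        * root n ^ ((d : ℕ) * a)) * root n ^ ((i : ℕ) * a) := by
    rcases eq_or_ne d 0 with rfl | hd
    · simp [coupling_self]
    · have : ((d : ℕ) ≠ 0) := fun h => hd (Fin.ext (by simpa using h))
      rw [if_neg this, Equiv.coe_addLeft, coupling_self_add α i d hd, Fin.val_add, mul_assoc]
      congr 1
      rw [pow_mul, ← pow_eq_pow_mod _ hr, ← pow_mul, ← pow_add]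
      ring_nf
  simp only [h1]
  rw [← sum_mul]
  congr 1
  rw [Fin.sum_univ_eq_sum_range (fun d => if d = 0 then 0 else
    ((1 / (d : ℝ) ^ α + 1 / ((n : ℝ) - d) ^ α : ℝ) : ℂ) * root n ^ (d * a)), range_eq_Ico,
    sum_eq_sum_Ico_succ_bot (Nat.pos_of_ne_zero hn), if_pos rfl, zero_add, zero_add]
  -- Reflecting d to n - d turns the second half of the coupling into the conjugate of the first, so
  -- the eigenvalue is twice a real part.
  have h2 : ∑ d ∈ Ico 1 n, ((1 / ((n : ℝ) - d) ^ α : ℝ) : ℂ) * root n ^ (d * a) =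
      ∑ d ∈ Ico 1 n, ((1 / (d : ℝ) ^ α : ℝ) : ℂ) * star (root n ^ (d * a)) := by
    have := sum_Ico_reflect
      (fun d => ((1 / (d : ℝ) ^ α : ℝ) : ℂ) * star (root n ^ (d * a))) 1 (Nat.le_succ n)
    rw [Nat.add_sub_cancel_left, Nat.add_sub_cancel] at this
    rw [← this]
    refine sum_congr rfl fun d hd => ?_
    have hd := (mem_Ico.1 hd).2.le
    rw [Nat.cast_sub hd, root_pow_sub_mul hd hn, star_star]
  calc _ = ∑ d ∈ Ico 1 n, (((1 / (d : ℝ) ^ α : ℝ) : ℂ) * root n ^ (d * a) +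
          ((1 / ((n : ℝ) - d) ^ α : ℝ) : ℂ) * root n ^ (d * a)) := by
        refine sum_congr rfl fun d hd => ?_
        rw [if_neg (by have := (mem_Ico.1 hd).1; omega), Complex.ofReal_add, add_mul]
    _ = _ := by
        rw [sum_add_distrib, h2, ← sum_add_distrib, dispersion, mul_sum, Complex.ofReal_sum]
        refine sum_congr rfl fun d _ => ?_
        rw [← mul_add, ← starRingEnd_apply, Complex.add_conj, re_root_pow]
        push_cast
        ring

theorem fourierMatrix_mem_unitary (n : ℕ) :
    fourierMatrix n ∈ unitary (Matrix (Fin n) (Fin n) ℂ) := by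
  rcases n.eq_zero_or_pos with rfl | hn
  · rw [Unitary.mem_iff]; constructor <;> exact Subsingleton.elim _ _
  have hs : (fourierMatrix n)ᴴ * fourierMatrix n = 1 := by
    ext k l
    have hp := root_isPrimitiveRoot hn.ne'
    have h1 (j : Fin n) : (fourierMatrix n)ᴴ k j * fourierMatrix n j l =
        (1 / n : ℂ) * (root n ^ (l : ℕ) / root n ^ (k : ℕ)) ^ (j : ℕ) := by
      have e : ((1 / √(n : ℝ) : ℝ) : ℂ) * ((1 / √(n : ℝ) : ℝ) : ℂ) = 1 / n := by
        rw [← Complex.ofReal_mul, div_mul_div_comm, mul_self_sqrt (by positivity)]; simp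
      simp only [conjTranspose_apply, fourierMatrix, of_apply, star_mul', star_pow, conj_root]
      rw [← e, div_pow, ← pow_mul, ← pow_mul, mul_comm (l : ℕ), mul_comm (k : ℕ), inv_pow,
        ← starRingEnd_apply, Complex.conj_ofReal]
      ring
    rw [mul_apply]
    simp only [h1]
    rw [← mul_sum, Fin.sum_univ_eq_sum_range
      (fun j => (root n ^ (l : ℕ) / root n ^ (k : ℕ)) ^ j)]
    have hk0 : root n ^ (k : ℕ) ≠ 0 := pow_ne_zero _ (root_ne_zero n)
    rcases eq_or_ne k l with rfl | hkl
    · rw [div_self hk0]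
      simp [hn.ne']
    · rw [one_apply_ne hkl]
      have hq : root n ^ (l : ℕ) / root n ^ (k : ℕ) ≠ 1 := by
        rw [Ne, div_eq_one_iff_eq hk0]
        exact fun h => hkl (Fin.ext (hp.pow_inj l.isLt k.isLt h).symm)
      rw [geom_sum_eq hq, div_pow, ← pow_mul, ← pow_mul, mul_comm (l : ℕ), mul_comm (k : ℕ),
        pow_mul, pow_mul, hp.pow_eq_one]
      simp
  rw [Unitary.mem_iff]
  exact ⟨hs, mul_eq_one_comm.1 hs⟩

/-- The clock sends the plane wave of momentum k to that of momentum k + 1, and both are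
eigenvectors of the chain. -/
theorem commutator_chainHamiltonian_clock (n : ℕ) (α : ℝ) :
    chainHamiltonian n α * clock n - clock n * chainHamiltonian n α =
      clock n * fourierMatrix n *
        diagonal (fun k : Fin n => ((dispersion n α (k + 1) - dispersion n α k : ℝ) : ℂ)) *
        star (fourierMatrix n) := by
  have hU := Unitary.mem_iff.1 (fourierMatrix_mem_unitary n)
  have h : (chainHamiltonian n α * clock n - clock n * chainHamiltonian n α) * fourierMatrix n =
      clock n * fourierMatrix n *
        diagonal (fun k : Fin n => ((dispersion n α (k + 1) - dispersion n α k : ℝ) : ℂ)) := by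
    ext i k
    rw [sub_mul, Matrix.sub_apply, Matrix.mul_assoc, Matrix.mul_assoc (clock n), mul_diagonal,
      mul_apply]
    simp only [clock, diagonal_mul]
    rw [mul_apply]
    simp only [chainHamiltonian, fourierMatrix, of_apply]
    have h1 := sum_coupling_mul_root_pow α i ((k : ℕ) + 1)
    have h2 := sum_coupling_mul_root_pow α i (k : ℕ)
    generalize ((1 / √(n : ℝ) : ℝ) : ℂ) = c
    calc _ = c * (∑ j : Fin n, (coupling n α i j : ℂ) * root n ^ ((j : ℕ) * (k + 1))) -
          root n ^ (i : ℕ) * (c * ∑ j : Fin n, (coupling n α i j : ℂ) * root n ^ ((j : ℕ) * k)) := by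
          simp only [mul_sum]
          congr 1 <;> exact sum_congr rfl fun j _ => by ring
      _ = _ := by
          rw [h1, h2]; push_cast; ring
  rw [← h, Matrix.mul_assoc, hU.2, Matrix.mul_one]

theorem clock_mem_unitary (n : ℕ) : clock n ∈ unitary (Matrix (Fin n) (Fin n) ℂ) := by
  have h : star (clock n) * clock n = 1 := by
    rw [clock, star_eq_conjTranspose, diagonal_conjTranspose, diagonal_mul_diagonal,
      ← diagonal_one]
    congr 1
    ext j
    rw [Pi.star_apply, star_pow, conj_root, inv_pow,
      inv_mul_cancel₀ (pow_ne_zero _ (root_ne_zero n))]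
  rw [Unitary.mem_iff]
  exact ⟨h, mul_eq_one_comm.1 h⟩

/-- An inequality rather than an equality, so that the zero ring (n = 0) is covered. -/
theorem norm_le_one_of_mem_unitary {𝔸 : Type*} [NormedRing 𝔸] [StarRing 𝔸] [CStarRing 𝔸] {U : 𝔸}
    (hU : U ∈ unitary 𝔸) : ‖U‖ ≤ 1 := by
  cases subsingleton_or_nontrivial 𝔸
  · rw [Subsingleton.elim U 0, norm_zero]; exact zero_le_one
  · exact (CStarRing.norm_of_mem_unitary hU).le

theorem norm_commutator_chainHamiltonian_clock_le {n : ℕ} {α δ : ℝ} (hδ : 0 ≤ δ)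
    (h : ∀ k < n, |dispersion n α (k + 1) - dispersion n α k| ≤ δ) :
    ‖chainHamiltonian n α * clock n - clock n * chainHamiltonian n α‖ ≤ δ := by
  have hU := fourierMatrix_mem_unitary n
  have hd : ‖diagonal (fun k : Fin n =>
      ((dispersion n α (k + 1) - dispersion n α k : ℝ) : ℂ))‖ ≤ δ := by
    rw [l2_opNorm_diagonal, pi_norm_le_iff_of_nonneg hδ]
    intro k; rw [Complex.norm_real]; exact h k k.isLt
  rw [commutator_chainHamiltonian_clock]
  calc _ ≤ ‖clock n‖ * ‖fourierMatrix n‖ * _ * ‖star (fourierMatrix n)‖ := norm_mul₃_le.trans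
        (by gcongr; exact norm_mul_le _ _)
    _ ≤ 1 * 1 * δ * 1 := by
        gcongr
        · exact norm_le_one_of_mem_unitary (clock_mem_unitary n)
        · exact norm_le_one_of_mem_unitary hU
        · exact norm_le_one_of_mem_unitary (Unitary.star_mem hU)
    _ = δ := by ring

theorem norm_commutator_pow_le {n : ℕ} {A D : Matrix (Fin n) (Fin n) ℂ} {δ : ℝ}
    (hD : D ∈ unitary (Matrix (Fin n) (Fin n) ℂ))
    (h : ‖A * D - D * A‖ ≤ δ) (m : ℕ) : ‖A * D ^ m - D ^ m * A‖ ≤ m * δ := by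
  induction m with
  | zero => simp
  | succ m ih =>
    have e : A * D ^ (m + 1) - D ^ (m + 1) * A =
        (A * D - D * A) * D ^ m + D * (A * D ^ m - D ^ m * A) := by
      rw [pow_succ']; noncomm_ring
    have hδ : 0 ≤ δ := (norm_nonneg _).trans h
    calc _ ≤ ‖A * D - D * A‖ * ‖D ^ m‖ + ‖D‖ * ‖A * D ^ m - D ^ m * A‖ := by
          rw [e]; exact (norm_add_le _ _).trans (add_le_add (norm_mul_le _ _) (norm_mul_le _ _))
      _ ≤ δ * 1 + 1 * (m * δ) := by
          gcongr
          · exact norm_le_one_of_mem_unitary (pow_mem hD m)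
          · exact norm_le_one_of_mem_unitary hD
      _ = _ := by push_cast; ring

end SpatialSearch
-- Localising with a Dirichlet kernel
/-- The time evolution `exp (-i T H_search)`. -/
noncomputable def SpatialSearch.evolution (n : ℕ) (α γ : ℝ) (w : Fin n) (T : ℝ) :
    Matrix (Fin n) (Fin n) ℂ :=
  NormedSpace.exp ((-(Complex.I * (T : ℂ))) • SpatialSearch.searchHamiltonian n α γ w)

/-- The Dirichlet kernel with `M` frequencies centred at the site `w`, normalised to `1` at `w`. -/
noncomputable def SpatialSearch.dirichletKernel (n M : ℕ) (w : Fin n) :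
    Matrix (Fin n) (Fin n) ℂ :=
  (1 / M : ℂ) • ∑ m ∈ Finset.range M, (star (SpatialSearch.root n) ^ ((w : ℕ) * m)) •
    SpatialSearch.clock n ^ m

namespace SpatialSearch
open Finset Real Matrix
open scoped Matrix.Norms.L2Operator

theorem exp_neg_I_mul_smul_mem_unitary {𝔸 : Type*} [CStarAlgebra 𝔸] {A : 𝔸}
    (hA : IsSelfAdjoint A) (t : ℝ) :
    NormedSpace.exp ((-(Complex.I * (t : ℂ))) • A) ∈ unitary 𝔸 := by
  let +nondep : NormedAlgebra ℚ 𝔸 := .restrictScalars ℚ ℂ 𝔸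
  refine NormedSpace.exp_mem_unitary_of_mem_skewAdjoint (hA.smul_mem_skewAdjoint ?_)
  simp [skewAdjoint.mem_iff]

/-- An observable is transported by the unitary evolution at speed at most the norm of its
commutator with the generator. -/
theorem norm_commutator_exp_le {𝔸 : Type*} [CStarAlgebra 𝔸] {A : 𝔸} (hA : IsSelfAdjoint A)
    (g : 𝔸) {T : ℝ} (hT : 0 ≤ T) :
    ‖g * NormedSpace.exp ((-(Complex.I * (T : ℂ))) • A) -
      NormedSpace.exp ((-(Complex.I * (T : ℂ))) • A) * g‖ ≤ T * ‖A * g - g * A‖ := by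
  let +nondep : NormedAlgebra ℚ 𝔸 := .restrictScalars ℚ ℂ 𝔸
  set B : 𝔸 := (-Complex.I) • A with hB
  have hexp (t : ℝ) : (-(Complex.I * (t : ℂ))) • A = t • B := by
    rw [hB, ← smul_assoc]; congr 1; rw [Complex.real_smul]; ring
  have hU (t : ℝ) : ‖NormedSpace.exp (t • B)‖ ≤ 1 := by
    rw [← hexp]; exact norm_le_one_of_mem_unitary (exp_neg_I_mul_smul_mem_unitary hA t)
  have hinv (t : ℝ) : NormedSpace.exp (t • B) * NormedSpace.exp ((-t) • B) = 1 := by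
    rw [← NormedSpace.exp_add_of_commute (((Commute.refl B).smul_left t).smul_right (-t)),
      ← add_smul, add_neg_cancel, zero_smul, NormedSpace.exp_zero]
  have hcomm : ‖g * B - B * g‖ = ‖A * g - g * A‖ := by
    have : g * B - B * g = Complex.I • (A * g - g * A) := by
      rw [hB, mul_smul_comm, smul_mul_assoc, smul_sub, neg_smul, neg_smul]; abel
    rw [this, norm_smul, Complex.norm_I, one_mul]
  -- Heisenberg picture: the derivative of f is a unitary conjugate of the commutator, so the mean
  -- value inequality applies.
  let f : ℝ → 𝔸 := fun t => NormedSpace.exp ((-t) • B) * g * NormedSpace.exp (t • B)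
  have hf (t : ℝ) : HasDerivAt f
      (NormedSpace.exp ((-t) • B) * (g * B - B * g) * NormedSpace.exp (t • B)) t := by
    have h1 : HasDerivAt (fun u : ℝ => NormedSpace.exp (u • B))
      (B * NormedSpace.exp (t • B)) t := hasDerivAt_exp_smul_const' B t
    have h2 : HasDerivAt (fun u : ℝ => NormedSpace.exp ((-u) • B))
        (-(NormedSpace.exp ((-t) • B) * B)) t := by
      have h := (hasDerivAt_exp_smul_const B (-t)).scomp t (hasDerivAt_neg t)
      rw [neg_one_smul] at h
      exact h
    have h3 := (h2.mul_const g).mul h1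
    have e : NormedSpace.exp ((-t) • B) * (g * B - B * g) * NormedSpace.exp (t • B) =
        -(NormedSpace.exp ((-t) • B) * B) * g * NormedSpace.exp (t • B) +
          NormedSpace.exp ((-t) • B) * g * (B * NormedSpace.exp (t • B)) := by
      noncomm_ring
    rw [e]
    exact h3
  have hmv := norm_image_sub_le_of_norm_deriv_le_segment' (a := 0) (b := T)
    (C := ‖A * g - g * A‖) (fun t _ => (hf t).hasDerivWithinAt) (fun t _ => by
      rw [← hcomm]
      calc _ ≤ ‖NormedSpace.exp ((-t) • B)‖ * ‖g * B - B * g‖ * ‖NormedSpace.exp (t • B)‖ :=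
            norm_mul₃_le
        _ ≤ 1 * ‖g * B - B * g‖ * 1 := by gcongr; exacts [hU _, hU _]
        _ = _ := by ring) T ⟨hT, le_rfl⟩
  rw [sub_zero, mul_comm] at hmv
  refine le_trans ?_ hmv
  rw [hexp]
  have e : g * NormedSpace.exp (T • B) - NormedSpace.exp (T • B) * g =
      NormedSpace.exp (T • B) * (f T - f 0) := by
    simp only [f, neg_zero, zero_smul, NormedSpace.exp_zero, one_mul, mul_one, mul_sub]
    rw [← mul_assoc, ← mul_assoc, hinv, one_mul]
  rw [e]
  calc _ ≤ ‖NormedSpace.exp (T • B)‖ * ‖f T - f 0‖ := norm_mul_le _ _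
    _ ≤ 1 * ‖f T - f 0‖ := by gcongr; exact hU T
    _ = _ := one_mul _

theorem isSelfAdjoint_searchHamiltonian (n : ℕ) (α γ : ℝ) (w : Fin n) :
    IsSelfAdjoint (searchHamiltonian n α γ w) := by
  rw [isSelfAdjoint_iff, star_eq_conjTranspose]
  have h : (chainHamiltonian n α)ᴴ = chainHamiltonian n α := by
    ext i j
    rw [conjTranspose_apply, chainHamiltonian, of_apply, of_apply, coupling_comm n α j i,
      ← starRingEnd_apply, Complex.conj_ofReal]
  rw [searchHamiltonian, conjTranspose_add, conjTranspose_smul, conjTranspose_single, h, star_one,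
    ← starRingEnd_apply, Complex.conj_ofReal]

theorem evolution_mem_unitary (n : ℕ) (α γ : ℝ) (w : Fin n) (T : ℝ) :
    evolution n α γ w T ∈ unitary (Matrix (Fin n) (Fin n) ℂ) :=
  exp_neg_I_mul_smul_mem_unitary (isSelfAdjoint_searchHamiltonian n α γ w) T

theorem norm_mulVec_apply_le {n : ℕ} (A : Matrix (Fin n) (Fin n) ℂ) (x : Fin n → ℂ) (i : Fin n) :
    ‖(A *ᵥ x) i‖ ≤ ‖A‖ * √(∑ j, ‖x j‖ ^ 2) := by
  have h := l2_opNorm_mulVec A (WithLp.toLp 2 x)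
  rw [EuclideanSpace.norm_eq (WithLp.toLp 2 x)] at h
  exact (PiLp.norm_apply_le (p := 2) (WithLp.toLp 2 (A *ᵥ x)) i).trans h

theorem sum_norm_uniformState {n : ℕ} (hn : n ≠ 0) : ∑ j, ‖uniformState n j‖ ^ 2 = 1 := by
  simp [uniformState, hn]

theorem fidelity_eq (n : ℕ) (α γ : ℝ) (w : Fin n) (T : ℝ) :
    fidelity n α γ w T = ‖(evolution n α γ w T *ᵥ uniformState n) w‖ ^ 2 := rfl

theorem fidelity_nonneg (n : ℕ) (α γ : ℝ) (w : Fin n) (T : ℝ) : 0 ≤ fidelity n α γ w T := by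
  rw [fidelity_eq]; positivity

theorem fidelity_le_one (n : ℕ) (α γ : ℝ) (w : Fin n) (T : ℝ) : fidelity n α γ w T ≤ 1 := by
  have h := norm_mulVec_apply_le (evolution n α γ w T) (uniformState n) w
  rw [sum_norm_uniformState w.pos.ne', sqrt_one, mul_one] at h
  rw [fidelity_eq]
  exact pow_le_one₀ (norm_nonneg _)
    (h.trans (norm_le_one_of_mem_unitary (evolution_mem_unitary n α γ w T)))

theorem clock_pow_apply (n m : ℕ) :
    clock n ^ m = diagonal fun j : Fin n => root n ^ ((j : ℕ) * m) := by
  rw [clock, diagonal_pow]; congr 1; ext j; rw [Pi.pow_apply, pow_mul]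

theorem dirichletKernel_eq_diagonal (n M : ℕ) (w : Fin n) :
    dirichletKernel n M w = diagonal fun j : Fin n =>
      (1 / M : ℂ) * ∑ m ∈ range M, star (root n) ^ ((w : ℕ) * m) * root n ^ ((j : ℕ) * m) := by
  ext i j
  simp only [dirichletKernel, clock_pow_apply, Matrix.smul_apply, Matrix.sum_apply, smul_eq_mul,
    diagonal_apply]
  split_ifs <;> simp

theorem dirichletKernel_self {n M : ℕ} (hM : M ≠ 0) (w : Fin n) :
    (1 / M : ℂ) * ∑ m ∈ range M, star (root n) ^ ((w : ℕ) * m) * root n ^ ((w : ℕ) * m) = 1 := by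
  have h (m : ℕ) : star (root n) ^ ((w : ℕ) * m) * root n ^ ((w : ℕ) * m) = 1 := by
    rw [← mul_pow, conj_root, inv_mul_cancel₀ (root_ne_zero n), one_pow]
  simp only [h]
  simp [hM]

/-- The localised uniform state is a unitary image of a vector with `M` entries of modulus
`1 / M`. -/
theorem dirichletKernel_mulVec_uniformState {n M : ℕ} (hMn : M ≤ n) (w : Fin n) :
    dirichletKernel n M w *ᵥ uniformState n = fourierMatrix n *ᵥ fun m : Fin n =>
      if (m : ℕ) < M then (1 / M : ℂ) * star (root n) ^ ((w : ℕ) * m) else 0 := by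
  ext j
  rw [dirichletKernel_eq_diagonal, mulVec_diagonal, mulVec_eq_sum]
  simp only [Finset.sum_apply, Pi.smul_apply, MulOpposite.smul_eq_mul_unop,
    MulOpposite.unop_op, transpose_apply, fourierMatrix, of_apply, uniformState]
  rw [Fin.sum_univ_eq_sum_range (fun m => ((1 / √(n : ℝ) : ℝ) : ℂ) * root n ^ ((j : ℕ) * m) *
    (if m < M then (1 / M : ℂ) * star (root n) ^ ((w : ℕ) * m) else 0))]
  simp only [mul_ite, mul_zero]
  rw [← sum_filter, show (range n).filter (· < M) = range M by ext; simp; omega, mul_sum, sum_mul]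
  exact sum_congr rfl fun m _ => by ring

theorem sum_norm_dirichlet_coeff {n M : ℕ} (hMn : M ≤ n) (w : Fin n) :
    ∑ m : Fin n, ‖(if (m : ℕ) < M then (1 / M : ℂ) * star (root n) ^ ((w : ℕ) * m) else 0)‖ ^ 2 =
      1 / M := by
  rw [Fin.sum_univ_eq_sum_range (fun m : ℕ =>
    ‖(if m < M then (1 / M : ℂ) * star (root n) ^ ((w : ℕ) * m) else 0)‖ ^ 2)]
  have h (m : ℕ) : ‖(if m < M then (1 / M : ℂ) * star (root n) ^ ((w : ℕ) * m) else 0)‖ ^ 2 =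
      if m < M then (1 / M : ℝ) ^ 2 else 0 := by
    split_ifs <;> simp [norm_root]
  simp only [h]
  rw [← sum_filter, show (range n).filter (· < M) = range M by ext; simp; omega, sum_const,
    card_range, nsmul_eq_mul]
  rcases eq_or_ne M 0 with rfl | hM
  · simp
  · field_simp

theorem commute_single_diagonal {n : ℕ} (w : Fin n) (v : Fin n → ℂ) :
    single w w (1 : ℂ) * diagonal v = diagonal v * single w w (1 : ℂ) := by
  ext i j
  rw [mul_diagonal, diagonal_mul, single_apply]
  split_ifs with h
  · rw [← h.1, ← h.2, one_mul, mul_one]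
  · simp

/-- The marked projector is diagonal and drops out; only hopping transports the clock. -/
theorem norm_commutator_searchHamiltonian_clock_le {n : ℕ} {α δ : ℝ} (γ : ℝ) (w : Fin n)
    (h : ∀ k < n, |dispersion n α (k + 1) - dispersion n α k| ≤ δ) :
    ‖searchHamiltonian n α γ w * clock n - clock n * searchHamiltonian n α γ w‖ ≤ |γ| * δ := by
  have e : searchHamiltonian n α γ w * clock n - clock n * searchHamiltonian n α γ w =
      (γ : ℂ) • (chainHamiltonian n α * clock n - clock n * chainHamiltonian n α) := by
    rw [searchHamiltonian, add_mul, mul_add, clock, commute_single_diagonal, Matrix.smul_mul,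
      Matrix.mul_smul, smul_sub]
    abel
  have hδ : 0 ≤ δ := (abs_nonneg _).trans (h 0 w.pos)
  rw [e, norm_smul, Complex.norm_real, Real.norm_eq_abs]
  gcongr
  exact norm_commutator_chainHamiltonian_clock_le hδ h

theorem norm_commutator_dirichletKernel_le {n : ℕ} {A : Matrix (Fin n) (Fin n) ℂ} {δ : ℝ}
    (h : ‖A * clock n - clock n * A‖ ≤ δ) (M : ℕ) (w : Fin n) :
    ‖A * dirichletKernel n M w - dirichletKernel n M w * A‖ ≤ M * δ := by
  have hδ : 0 ≤ δ := (norm_nonneg _).trans h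
  have e : A * dirichletKernel n M w - dirichletKernel n M w * A = (1 / M : ℂ) •
      ∑ m ∈ range M, (star (root n) ^ ((w : ℕ) * m)) • (A * clock n ^ m - clock n ^ m * A) := by
    simp only [dirichletKernel, Matrix.mul_smul, Matrix.smul_mul, mul_sum, sum_mul, ← smul_sub,
      ← sum_sub_distrib]
  rw [e, norm_smul]
  have hs : ‖∑ m ∈ range M, (star (root n) ^ ((w : ℕ) * m)) •
      (A * clock n ^ m - clock n ^ m * A)‖ ≤ M * (M * δ) := by
    refine (norm_sum_le_of_le (f := fun m => (star (root n) ^ ((w : ℕ) * m)) •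
      (A * clock n ^ m - clock n ^ m * A)) (range M) (n := fun _ => M * δ) fun m hm => ?_).trans ?_
    · rw [norm_smul, norm_pow, norm_star, norm_root, one_pow, one_mul]
      refine (norm_commutator_pow_le (clock_mem_unitary n) h m).trans ?_
      gcongr
      exact (mem_range.1 hm).le
    · simp
  rcases eq_or_ne M 0 with rfl | hM
  · simp
  · have hM' : (0 : ℝ) < M := by positivity
    calc _ ≤ ‖(1 / M : ℂ)‖ * (M * (M * δ)) := by gcongr
      _ = _ := by simp; field_simp

/-- The kernel is 1 at w, so it can be inserted after the evolution for free. Commuting it to the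
right costs the second term; it then shrinks the uniform state to norm 1/√M. -/
theorem sqrt_fidelity_le {n M : ℕ} {α δ : ℝ} (γ : ℝ) (w : Fin n) {T : ℝ} (hT : 0 ≤ T)
    (hM : M ≠ 0) (hMn : M ≤ n)
    (h : ∀ k < n, |dispersion n α (k + 1) - dispersion n α k| ≤ δ) :
    √(fidelity n α γ w T) ≤ √(1 / M) + |γ| * T * (M * δ) := by
  set U := evolution n α γ w T with hU
  set g := dirichletKernel n M w with hg
  have hUu := evolution_mem_unitary n α γ w T
  have hc : ‖g * U - U * g‖ ≤ T * (M * (|γ| * δ)) :=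
    (norm_commutator_exp_le (isSelfAdjoint_searchHamiltonian n α γ w) g hT).trans
      (mul_le_mul_of_nonneg_left (norm_commutator_dirichletKernel_le
        (norm_commutator_searchHamiltonian_clock_le γ w h) M w) hT)
  have e1 : (U *ᵥ uniformState n) w = (g *ᵥ (U *ᵥ uniformState n)) w := by
    rw [hg, dirichletKernel_eq_diagonal, mulVec_diagonal, dirichletKernel_self hM, one_mul]
  have e2 : (g *ᵥ (U *ᵥ uniformState n)) w =
      (U *ᵥ (g *ᵥ uniformState n)) w + ((g * U - U * g) *ᵥ uniformState n) w := by
    rw [Matrix.sub_mulVec, mulVec_mulVec, mulVec_mulVec, Pi.sub_apply]; ring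
  have b1 : ‖(U *ᵥ (g *ᵥ uniformState n)) w‖ ≤ √(1 / M) := by
    rw [hg, dirichletKernel_mulVec_uniformState hMn, mulVec_mulVec]
    refine (norm_mulVec_apply_le _ _ _).trans ?_
    rw [sum_norm_dirichlet_coeff hMn]
    exact mul_le_of_le_one_left (sqrt_nonneg _)
      (norm_le_one_of_mem_unitary (mul_mem hUu (fourierMatrix_mem_unitary n)))
  have b2 : ‖((g * U - U * g) *ᵥ uniformState n) w‖ ≤ T * (M * (|γ| * δ)) := by
    refine (norm_mulVec_apply_le _ _ _).trans ?_
    rwa [sum_norm_uniformState w.pos.ne', sqrt_one, mul_one]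
  rw [fidelity_eq, sqrt_sq (norm_nonneg _), ← hU, e1, e2]
  refine (norm_add_le _ _).trans (add_le_add b1 (b2.trans_eq ?_))
  ring

end SpatialSearch
-- The light-cone bound; bounding the hopping rate by energy conservation
/-- The Dirichlet form `∑ J_{ij} |x_i - x_j|²` of the chain. -/
noncomputable def SpatialSearch.dirichletForm (n : ℕ) (α : ℝ) (x : Fin n → ℂ) : ℝ :=
  ∑ i, ∑ j, SpatialSearch.coupling n α i j * ‖x i - x j‖ ^ 2

namespace SpatialSearch
open Finset Real Matrix

theorem exists_light_cone_bound {α : ℝ} (hα : 1 < α) : ∃ c : ℝ, 0 < c ∧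
    ∀ (n : ℕ) (w : Fin n) (γ T : ℝ), 0 ≤ T → 5 ≤ (n : ℝ) * fidelity n α γ w T →
      c * fidelity n α γ w T ^ (3 / 2 : ℝ) * (n : ℝ) ^ min (α - 1) 1 ≤ |γ| * T := by
  obtain ⟨C, hC, hdisp⟩ := exists_abs_dispersion_succ_sub_le hα
  refine ⟨1 / (10 * C), by positivity, fun n w γ T hT hF => ?_⟩
  have hn : (0 : ℝ) < n := by exact_mod_cast w.pos
  have hF0 : 0 < fidelity n α γ w T := by
    by_contra! h; nlinarith [fidelity_nonneg n α γ w T]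
  have hF1 := fidelity_le_one n α γ w T
  have key := fun M hM hMn => sqrt_fidelity_le (M := M) γ w hT hM hMn (fun k hk => hdisp n k hk)
  generalize fidelity n α γ w T = F at *
  set b := (n : ℝ) ^ min (α - 1) 1 with hb
  have hb0 : 0 < b := by positivity
  -- With M = ⌈4/F⌉ the term 1/√M uses at most half of √F. Since F ≤ 1, M ≤ 5/F, and this is at most
  -- n exactly when nF ≥ 5.
  have hM4 : 4 / F ≤ ⌈4 / F⌉₊ := Nat.le_ceil _
  have hM5 : (⌈4 / F⌉₊ : ℝ) ≤ 5 / F := by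
    have h1 := (Nat.ceil_lt_add_one (by positivity : 0 ≤ 4 / F)).le
    have h2 : 1 ≤ 1 / F := (one_le_div hF0).2 hF1
    calc _ ≤ 4 / F + 1 := h1
      _ ≤ 4 / F + 1 / F := by gcongr
      _ = _ := by ring
  have hMpos : (0 : ℝ) < ⌈4 / F⌉₊ := lt_of_lt_of_le (by positivity) hM4
  have h := key ⌈4 / F⌉₊ (by exact_mod_cast hMpos.ne') (by
    have : (⌈4 / F⌉₊ : ℝ) ≤ n := hM5.trans ((div_le_iff₀ hF0).2 hF)
    exact_mod_cast this)
  have h1 : √(1 / (⌈4 / F⌉₊ : ℝ)) ≤ √F / 2 := by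
    have : √F / 2 = √(F / 4) := by
      rw [sqrt_div hF0.le, show (4 : ℝ) = 2 ^ 2 by norm_num, sqrt_sq zero_le_two]
    rw [this]
    refine sqrt_le_sqrt ?_
    rw [one_div_le hMpos (by positivity), one_div_div]
    exact hM4
  have h2 : |γ| * T * (⌈4 / F⌉₊ * (C / b)) ≤ |γ| * T * (5 / F * (C / b)) := by gcongr
  have h3 : √F / 2 ≤ |γ| * T * (5 / F * (C / b)) := by linarith
  have e : F ^ (3 / 2 : ℝ) = F * √F := by
    rw [sqrt_eq_rpow, show (3 / 2 : ℝ) = 1 + 1 / 2 by norm_num, rpow_add hF0, rpow_one]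
  calc 1 / (10 * C) * F ^ (3 / 2 : ℝ) * b = (√F / 2) * (F * b / (5 * C)) := by
        rw [e]; field_simp; norm_num
    _ ≤ |γ| * T * (5 / F * (C / b)) * (F * b / (5 * C)) := by gcongr
    _ = |γ| * T := by field_simp

theorem coupling_nonneg (n : ℕ) (α : ℝ) (i j : Fin n) : 0 ≤ coupling n α i j := by
  rw [coupling]
  split_ifs
  · exact le_rfl
  · have hi : (i : ℝ) ≤ n := by exact_mod_cast i.isLt.le
    have hj : (j : ℝ) ≤ n := by exact_mod_cast j.isLt.le
    have h : |(j : ℝ) - i| ≤ n := by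
      rw [abs_le]
      constructor <;> linarith [(Nat.cast_nonneg i.val : (0 : ℝ) ≤ i),
        (Nat.cast_nonneg j.val : (0 : ℝ) ≤ j)]
    have := rpow_nonneg (sub_nonneg.2 h) α
    positivity

theorem sum_coupling {n : ℕ} (α : ℝ) (i : Fin n) :
    ∑ j, coupling n α i j = dispersion n α 0 := by
  have h := sum_coupling_mul_root_pow α i 0
  simp only [Nat.mul_zero, pow_zero, mul_one] at h
  exact_mod_cast h

/-- All row sums of the coupling equal the zero-momentum eigenvalue, so the chain is that constant
minus a weighted graph Laplacian. The factor 1/2 appears because `dirichletForm` counts ordered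
pairs. -/
theorem dotProduct_chainHamiltonian_mulVec {n : ℕ} (α : ℝ) (x : Fin n → ℂ) :
    star x ⬝ᵥ chainHamiltonian n α *ᵥ x =
      ((dispersion n α 0 * ∑ i, ‖x i‖ ^ 2 - dirichletForm n α x / 2 : ℝ) : ℂ) := by
  have hr (i j : Fin n) : ((coupling n α i j * ‖x i - x j‖ ^ 2 : ℝ) : ℂ) =
      (coupling n α i j : ℂ) * (‖x i‖ ^ 2 : ℝ) + (coupling n α i j : ℂ) * (‖x j‖ ^ 2 : ℝ)
        - star (x i) * (coupling n α i j * x j) - star (x j) * (coupling n α i j * x i) := by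
    simp only [Complex.ofReal_mul, Complex.ofReal_pow, ← Complex.conj_mul', map_sub,
      ← starRingEnd_apply]
    ring
  have hs : ∑ i : Fin n, ∑ j : Fin n, (coupling n α i j : ℂ) * (‖x i‖ ^ 2 : ℝ) =
      (dispersion n α 0 * ∑ i, ‖x i‖ ^ 2 : ℝ) := by
    simp only [← sum_mul, ← Complex.ofReal_sum, sum_coupling]
    rw [← mul_sum, ← Complex.ofReal_sum, Complex.ofReal_mul]
  have hs' : ∑ i : Fin n, ∑ j : Fin n, (coupling n α i j : ℂ) * (‖x j‖ ^ 2 : ℝ) =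
      (dispersion n α 0 * ∑ i, ‖x i‖ ^ 2 : ℝ) := by
    rw [sum_comm, ← hs]
    simp only [coupling_comm n α]
  have hq : ∑ i : Fin n, ∑ j : Fin n, star (x i) * (coupling n α i j * x j) =
      star x ⬝ᵥ chainHamiltonian n α *ᵥ x := by
    simp only [dotProduct, mulVec, chainHamiltonian, of_apply, mul_sum, Pi.star_apply]
  have hq' : ∑ i : Fin n, ∑ j : Fin n, star (x j) * (coupling n α i j * x i) =
      star x ⬝ᵥ chainHamiltonian n α *ᵥ x := by
    rw [sum_comm, ← hq]
    simp only [coupling_comm n α]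
  have he : (dirichletForm n α x : ℂ) = 2 * (dispersion n α 0 * ∑ i, ‖x i‖ ^ 2 : ℝ) -
      2 * (star x ⬝ᵥ chainHamiltonian n α *ᵥ x) := by
    rw [dirichletForm, Complex.ofReal_sum]
    simp only [Complex.ofReal_sum, hr, sum_sub_distrib, sum_add_distrib]
    rw [hs, hs', hq, hq']
    ring
  rw [Complex.ofReal_sub, Complex.ofReal_div, he]
  push_cast
  ring

theorem dotProduct_searchHamiltonian_mulVec {n : ℕ} (α γ : ℝ) (w : Fin n) (x : Fin n → ℂ) :
    star x ⬝ᵥ searchHamiltonian n α γ w *ᵥ x =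
      ((γ * (dispersion n α 0 * ∑ i, ‖x i‖ ^ 2 - dirichletForm n α x / 2) + ‖x w‖ ^ 2 : ℝ) : ℂ) := by
  rw [searchHamiltonian, add_mulVec, dotProduct_add, smul_mulVec, dotProduct_smul,
    dotProduct_chainHamiltonian_mulVec, single_mulVec, one_mul]
  have : star x ⬝ᵥ Function.update 0 w (x w) = ((‖x w‖ ^ 2 : ℝ) : ℂ) := by
    rw [← Pi.single, dotProduct_single, Pi.star_apply, ← starRingEnd_apply, Complex.conj_mul']
    push_cast; rfl
  rw [this, smul_eq_mul]
  push_cast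
  ring

theorem dotProduct_star_mulVec_unitary {n : ℕ} {U : Matrix (Fin n) (Fin n) ℂ}
    (hU : U ∈ unitary (Matrix (Fin n) (Fin n) ℂ)) {A : Matrix (Fin n) (Fin n) ℂ}
    (hA : Commute A U) (x : Fin n → ℂ) :
    star (U *ᵥ x) ⬝ᵥ A *ᵥ (U *ᵥ x) = star x ⬝ᵥ A *ᵥ x := by
  have h : Uᴴ * U = 1 := (Unitary.mem_iff.1 hU).1
  rw [star_mulVec, ← dotProduct_mulVec, mulVec_mulVec, mulVec_mulVec, Matrix.mul_assoc, hA.eq,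
    ← Matrix.mul_assoc, h, Matrix.one_mul]

theorem sum_norm_sq_eq_dotProduct {n : ℕ} (x : Fin n → ℂ) :
    ((∑ i, ‖x i‖ ^ 2 : ℝ) : ℂ) = star x ⬝ᵥ x := by
  simp only [dotProduct, Complex.ofReal_sum, Complex.ofReal_pow, ← Complex.conj_mul',
    starRingEnd_apply, Pi.star_apply]

theorem sum_norm_evolution {n : ℕ} (α γ : ℝ) (w : Fin n) (T : ℝ) :
    ∑ i, ‖(evolution n α γ w T *ᵥ uniformState n) i‖ ^ 2 = 1 := by
  have h := dotProduct_star_mulVec_unitary (evolution_mem_unitary n α γ w T)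
    (Commute.one_left _) (uniformState n)
  rw [one_mulVec, one_mulVec, ← sum_norm_sq_eq_dotProduct, ← sum_norm_sq_eq_dotProduct,
    sum_norm_uniformState w.pos.ne'] at h
  exact_mod_cast h

theorem commute_searchHamiltonian_evolution (n : ℕ) (α γ : ℝ) (w : Fin n) (T : ℝ) :
    Commute (searchHamiltonian n α γ w) (evolution n α γ w T) :=
  ((Commute.refl _).smul_right _).exp_right

/-- Conservation of energy: the kinetic energy gained equals the potential energy gained. -/
theorem hopping_mul_dirichletForm_eq {n : ℕ} (α γ : ℝ) (w : Fin n) (T : ℝ) :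
    γ * dirichletForm n α (evolution n α γ w T *ᵥ uniformState n) =
      2 * (fidelity n α γ w T - 1 / n) := by
  have h := dotProduct_star_mulVec_unitary (evolution_mem_unitary n α γ w T)
    (commute_searchHamiltonian_evolution n α γ w T) (uniformState n)
  rw [dotProduct_searchHamiltonian_mulVec, dotProduct_searchHamiltonian_mulVec,
    sum_norm_evolution, sum_norm_uniformState w.pos.ne', ← fidelity_eq] at h
  -- The zero-momentum terms cancel because the norm is conserved, and the constant initial state
  -- has no Dirichlet energy.
  have h0 : dirichletForm n α (uniformState n) = 0 := by simp [dirichletForm, uniformState]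
  have h1 : ‖uniformState n w‖ ^ 2 = 1 / n := by simp [uniformState]
  rw [h0, h1] at h
  have h := Complex.ofReal_injective h
  linarith

/-- Pigeonhole: the M sites following w cannot all carry weight above p/4, as Mp/4 > 1. At one of
them the amplitude is at most half of √p, and its link to w alone gives a bound independent of n. -/
theorem le_dirichletForm {n M : ℕ} {α p : ℝ} (hα : 0 ≤ α) (hp : 0 < p) (hM : 4 / p < M)
    (hMn : M < n) (w : Fin n) {x : Fin n → ℂ} (hx : ∑ i, ‖x i‖ ^ 2 = 1) (hw : p ≤ ‖x w‖ ^ 2) :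
    1 / (M : ℝ) ^ α * (p / 4) ≤ dirichletForm n α x := by
  have : NeZero n := ⟨by omega⟩
  have hM0 : (0 : ℝ) < M := lt_trans (by positivity) hM
  let s : Fin M → Fin n := fun k => w + ⟨k + 1, by omega⟩
  have hs : Function.Injective s := fun a b hab => by
    have h := add_left_cancel hab
    simpa [Fin.ext_iff] using h
  obtain ⟨k, hk⟩ : ∃ k, ‖x (s k)‖ ^ 2 ≤ p / 4 := by
    by_contra! h
    have h1 : ∑ k : Fin M, ‖x (s k)‖ ^ 2 ≤ 1 := by
      rw [← hx, ← sum_image (s := univ) (g := s) (f := fun i => ‖x i‖ ^ 2) hs.injOn]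
      exact sum_le_sum_of_subset_of_nonneg (subset_univ _) fun _ _ _ => by positivity
    have h2 : ∑ _k : Fin M, p / 4 ≤ ∑ k : Fin M, ‖x (s k)‖ ^ 2 :=
      sum_le_sum fun k _ => (h k).le
    rw [sum_const, card_univ, Fintype.card_fin, nsmul_eq_mul] at h2
    rw [div_lt_iff₀ hp] at hM
    linarith
  have hd : (⟨k + 1, by omega⟩ : Fin n) ≠ 0 := fun h => by simp [Fin.ext_iff] at h
  have hJ : 1 / (M : ℝ) ^ α ≤ coupling n α w (s k) := by
    rw [coupling_self_add α w _ hd]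
    have h1 : ((k : ℕ) : ℝ) + 1 ≤ M := by exact_mod_cast k.isLt
    have h2 : (M : ℝ) ≤ n := by exact_mod_cast hMn.le
    push_cast
    refine le_add_of_le_of_nonneg ?_ ?_
    · exact one_div_le_one_div_of_le (by positivity) (rpow_le_rpow (by positivity) h1 hα)
    · exact one_div_nonneg.2 (rpow_nonneg (by linarith) _)
  have hdiff : p / 4 ≤ ‖x w - x (s k)‖ ^ 2 := by
    have hsq : (√p / 2) ^ 2 = p / 4 := by rw [div_pow, sq_sqrt hp.le]; norm_num
    have h1 : √p ≤ ‖x w‖ := sqrt_le_iff.2 ⟨norm_nonneg _, hw⟩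
    have h2 : ‖x (s k)‖ ≤ √p / 2 := by
      refine le_of_sq_le_sq ?_ (by positivity)
      rwa [hsq]
    rw [← hsq]
    have h3 := norm_sub_norm_le (x w) (x (s k))
    gcongr
    linarith
  have hnn (i j : Fin n) : 0 ≤ coupling n α i j * ‖x i - x j‖ ^ 2 :=
    mul_nonneg (coupling_nonneg n α i j) (by positivity)
  calc _ ≤ coupling n α w (s k) * ‖x w - x (s k)‖ ^ 2 := by
        gcongr
        exact coupling_nonneg _ _ _ _
    _ ≤ ∑ j, coupling n α w j * ‖x w - x j‖ ^ 2 :=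
        single_le_sum (f := fun j => coupling n α w j * ‖x w - x j‖ ^ 2)
          (fun j _ => hnn w j) (mem_univ (s k))
    _ ≤ _ := single_le_sum (f := fun i => ∑ j, coupling n α i j * ‖x i - x j‖ ^ 2)
          (fun i _ => sum_nonneg fun j _ => hnn i j) (mem_univ w)

/-- The potential energy gained is bounded, whereas the Dirichlet form at success is bounded below;
a large hopping rate would violate the energy balance. -/
theorem exists_abs_hopping_le {α p : ℝ} (hα : 0 ≤ α) (hp : 0 < p) : ∃ Γ : ℝ, 0 < Γ ∧ ∃ N : ℕ,
    ∀ n ≥ N, ∀ (w : Fin n) (γ T : ℝ), p ≤ fidelity n α γ w T → |γ| ≤ Γ := by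
  obtain ⟨M, hM⟩ := exists_nat_gt (4 / p)
  have hM0 : (0 : ℝ) < M := lt_trans (by positivity) hM
  set E := 1 / (M : ℝ) ^ α * (p / 4)
  have hE : 0 < E := by positivity
  refine ⟨2 / E, by positivity, M + 1, fun n hn w γ T hF => ?_⟩
  have h1 := le_dirichletForm hα hp hM (by omega : M < n) w (sum_norm_evolution α γ w T)
    (hF.trans_eq (fidelity_eq n α γ w T))
  have h2 := hopping_mul_dirichletForm_eq α γ w T
  have h3 : |2 * (fidelity n α γ w T - 1 / n)| ≤ 2 := by
    have hn1 : (1 : ℝ) ≤ n := by exact_mod_cast w.pos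
    have h4 : 1 / (n : ℝ) ≤ 1 := div_le_one_of_le₀ hn1 (by linarith)
    have h5 : 0 ≤ 1 / (n : ℝ) := by positivity
    have h6 := fidelity_le_one n α γ w T
    have h7 := fidelity_nonneg n α γ w T
    rw [abs_le]; constructor <;> linarith
  rw [← h2, abs_mul, abs_of_pos (hE.trans_le h1)] at h3
  rw [le_div_iff₀ hE]
  exact (mul_le_mul_of_nonneg_left h1 (abs_nonneg γ)).trans h3

/-! ### Search time and the absence of optimal search -/

theorem exists_search_time_bound {α p : ℝ} (hα : 1 < α) (hp : 0 < p) : ∃ c : ℝ, 0 < c ∧ ∃ N : ℕ,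
    ∀ n : ℕ, N ≤ n → ∀ (w : Fin n) (γ T : ℝ), 0 ≤ T → p ≤ fidelity n α γ w T →
      c * (n : ℝ) ^ min (α - 1) 1 ≤ T := by
  obtain ⟨c, hc, hcone⟩ := exists_light_cone_bound hα
  obtain ⟨Γ, hΓ, N, hN⟩ := exists_abs_hopping_le (by linarith : 0 ≤ α) hp
  obtain ⟨K, hK⟩ := exists_nat_ge (5 / p)
  -- `K` ensures np ≥ 5, the threshold of the light-cone bound; `N` is where the bound on |γ| sets
  -- in.
  refine ⟨c * p ^ (3 / 2 : ℝ) / Γ, by positivity, max N K, fun n hn w γ T hT hF => ?_⟩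
  have hKn : 5 / p ≤ n := hK.trans (by exact_mod_cast (le_max_right N K).trans hn)
  have h1 := hcone n w γ T hT (((div_le_iff₀ hp).1 hKn).trans (by gcongr))
  have h2 := hN n ((le_max_left N K).trans hn) w γ T hF
  rw [div_mul_eq_mul_div, div_le_iff₀ hΓ]
  calc _ ≤ c * fidelity n α γ w T ^ (3 / 2 : ℝ) * (n : ℝ) ^ min (α - 1) 1 := by gcongr
    _ ≤ |γ| * T := h1
    _ ≤ Γ * T := by gcongr
    _ = T * Γ := mul_comm _ _

theorem tendsto_rpow_div_sqrt {α : ℝ} (hα : 3 / 2 < α) :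
    Filter.Tendsto (fun n : ℕ => (n : ℝ) ^ min (α - 1) 1 / √(n : ℝ)) Filter.atTop Filter.atTop := by
  have h : 0 < min (α - 1) 1 - 1 / 2 := by
    rw [sub_pos, lt_min_iff]; constructor <;> linarith
  refine ((tendsto_rpow_atTop h).comp tendsto_natCast_atTop_atTop).congr' ?_
  filter_upwards [Filter.eventually_gt_atTop 0] with n hn
  rw [Function.comp_apply, sqrt_eq_rpow, rpow_sub (by exact_mod_cast hn)]

theorem not_optimalSearch {α : ℝ} (hα : 3 / 2 < α) : ¬ OptimalSearch α := by
  rintro ⟨γ, T, C, p, hp, hev⟩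
  obtain ⟨c, hc, N, hN⟩ := exists_search_time_bound (by linarith : 1 < α) hp
  obtain ⟨n, ⟨hT, hTC, hF⟩, hnN, hn, hbig⟩ := (hev.and ((Filter.eventually_ge_atTop N).and
    ((Filter.eventually_gt_atTop 0).and
      ((tendsto_rpow_div_sqrt hα).eventually_gt_atTop (C / c))))).exists
  have hs : 0 < √(n : ℝ) := sqrt_pos.2 (by exact_mod_cast hn)
  have h := hN n hnN ⟨0, hn⟩ (γ n) (T n) hT (hF _)
  rw [div_lt_div_iff₀ hc hs] at hbig
  linarith

end SpatialSearch

theorem mainTheorem4 :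
    -- light-cone bound on the search time in units of the inverse hopping rate, for every success
    -- probability exceeding the guessing probability `1 / n` by a large enough constant factor
    (∀ α : ℝ, 1 < α → ∃ c : ℝ, 0 < c ∧ ∃ K : ℝ, ∀ (n : ℕ) (w : Fin n) (γ T : ℝ), 0 ≤ T →
      K ≤ (n : ℝ) * SpatialSearch.fidelity n α γ w T →
        c * SpatialSearch.fidelity n α γ w T ^ (3 / 2 : ℝ) * (n : ℝ) ^ min (α - 1) 1
          ≤ |γ| * T) ∧
    -- whatever the hopping rate, a fixed success probability `p` requires a time of order at least
    -- `n ^ (α - 1)` for `1 < α < 2`, and at least `n` for `α ≥ 2`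
    (∀ α : ℝ, 1 < α → ∀ p : ℝ, 0 < p → ∃ c : ℝ, 0 < c ∧ ∃ N : ℕ, ∀ n : ℕ, N ≤ n →
      ∀ (w : Fin n) (γ T : ℝ), 0 ≤ T → p ≤ SpatialSearch.fidelity n α γ w T →
        c * (n : ℝ) ^ min (α - 1) 1 ≤ T) ∧
    -- for `α > 3 / 2` this lower bound is of larger order than `√n`
    (∀ α : ℝ, 3 / 2 < α →
      Filter.Tendsto (fun n : ℕ => (n : ℝ) ^ min (α - 1) 1 / √(n : ℝ))
        Filter.atTop Filter.atTop) ∧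
    -- hence there is no optimal spatial search for `α > 3 / 2`
    (∀ α : ℝ, 3 / 2 < α → ¬ SpatialSearch.OptimalSearch α) := by
  exact ⟨fun α hα => (SpatialSearch.exists_light_cone_bound hα).imp fun c hc => ⟨hc.1, 5, hc.2⟩,
    fun α hα p hp => SpatialSearch.exists_search_time_bound hα hp,
    fun α hα => SpatialSearch.tendsto_rpow_div_sqrt hα,
    fun α hα => SpatialSearch.not_optimalSearch hα⟩
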